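/- Let $\theta_3=4.84$. For a key $K\in\{0,1,\dots,7\}$ (three bits) and $v\in\mathbb R$ let the shifting+mirroring encoding be $$\mathcal E(v,K)=\begin{cases} v & |v|>\theta_3,\ K<4,\\ -v & |v|>\theta_3,\ K\ge 4,\\ v+K\,\tfrac{2\theta_3}{8}\ \bmod\ [-\theta_3,\theta_3) & v\in[-\theta_3,\theta_3),\end{cases}$$ where $r \bmod [a,b)$ is the unique element of $[a,b)$ that differs from $r$ by an integer multiple of $b-a$. (The single value $v=\theta_3$, which occurs with probability zero, is immaterial; set $\mathcal E(\theta_3,K)=\theta_3$.) Let $\mu\in\mathbb R$, $\sigma>0$, let $X\sim\mathcal N(\mu,\sigma^2)$, and let the key $K$ be uniform on $\{0,\dots,7\}$ and independent of $X$. The sender transmits $Z=\big(\mu,\sigma^2,\mathcal E((X-\mu)/\sigma,K)\big)$. Then: 1. Decoding is lossless: there is a measurable decoding function $\Gamma$, not depending on $\mu,\sigma$, such that $\Gamma(Z,K)=X$ for all values of $X$ and $K$. 2. An eavesdropper who observes nothing has distortion $\operatorname{Var}(X)=\sigma^2$ (the perfect distortion). An eavesdropper who observes $Z$, but not $K$,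 has worst-case distortion $D_W=\min_Z \operatorname{Var}(X\mid Z)$ (the essential infimum of the conditional variance of $X$ given $Z$) satisfying $$0.9998\,\sigma^2\ \le\ D_W\ \le\ 0.99985\,\sigma^2 ,$$ that is, $D_W/\sigma^2\approx 0.9998$. -/

import Mathlib

open MeasureTheory ProbabilityTheory

noncomputable section

/-- The shifting+mirroring encoding of a real number `x` under a `k`-bit key `K`, with public
window parameter `θ > 0`:
outside the window `[-θ, θ]` the upper half of the keys reflects `x` across the origin and the
lower half leaves it unchanged; in the window `[-θ, θ)` the point is shifted by `K` subwindows of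
length `2θ / 2 ^ k`, modulo `[-θ, θ)`.
The remaining point `x = θ` is never transmitted by the scheme (it has probability zero); here it
is sent to itself, so that the encoding is a total function. -/
def shiftMirror (k : ℕ) (θ : ℝ) (hθ : 0 < θ) (x : ℝ) (K : Fin (2 ^ k)) : ℝ :=
  if θ < |x| then
    if (K : ℕ) < 2 ^ (k - 1) then x else -x
  else if x < θ then
    toIcoMod (mul_pos two_pos hθ) (-θ) (x + ((K : ℕ) : ℝ) * (2 * θ / 2 ^ k))
  else x

/-- The window parameter used with three key bits. -/
def theta3 : ℝ := 4.84

theorem theta3_pos : 0 < theta3 := by norm_num [theta3]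

/-- Everything that is transmitted for a sample `x` of a Gaussian with mean `μ` and standard
deviation `σ`: the mean and the variance uncoded, and the three-bit shifting+mirroring encoding of
the standardized sample `(x - μ) / σ`. -/
def transmit (μ σ x : ℝ) (K : Fin (2 ^ 3)) : ℝ × ℝ × ℝ :=
  (μ, σ ^ 2, shiftMirror 3 theta3 theta3_pos ((x - μ) / σ) K)

/-- The distortion of an eavesdropper who observes nothing: the variance of `X`. -/
def perfectDistortion {Ω : Type*} [MeasurableSpace Ω] (P : Measure Ω) (X : Ω → ℝ) : ℝ :=
  Var[X; P]

/-- The worst-case distortion `D_W = min_Z Var(X | Z)` of an eavesdropper who observes `Z`.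
As `Var(X | Z)` is determined only up to events of probability zero, the minimum over the observed
values is the essential infimum. -/
def worstCaseDistortion {Ω E : Type*} [MeasurableSpace Ω] [mE : MeasurableSpace E]
    (P : Measure Ω) (X : Ω → ℝ) (Z : Ω → E) : ℝ :=
  essInf (Var[X; P | mE.comap Z]) P

end

/-! Each key acts on the standardized sample as a bijection of the line that preserves Lebesgue
measure. Hence, given a code `z`, the sample is one of the eight decodings of `z`, with weights
proportional to the standard Gaussian density there (`condExp_comp_ae_eq_of_conditional_density`,
`map_restrict_maskedSample`), and `Var(X | Z)` is `σ ^ 2 * posteriorVar z`.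

Outside the window the decodings are `z` and `-z` with equal weight, so the variance is `z ^ 2`, far
above 1. Inside, they are the eight points `s + 1.21 * i`, `-4 ≤ i ≤ 3`, with weights proportional
to `q ^ (i ^ 2) * u ^ i`, where `q = exp (-1.21 ^ 2 / 2)` and `u = exp (-1.21 * s)`: a Gaussian
sampled on a truncated lattice, whose variance is close to 1 (`posteriorVar_lattice`).

The lower bound becomes a polynomial inequality of degree 14 in `u` on `[0.23, 1]`
(`latticeMoment_variance_lower`). The upper bound is a numerical check at `u = 1`, extended by
continuity to an interval of codes, which has positive probability. -/

/-! ### Bayes' formula for a discrete key and a code with conditional densities. -/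

section Bayes

variable {Ω E ι : Type*} [MeasurableSpace Ω] [mE : MeasurableSpace E] [Fintype ι]
  [MeasurableSpace ι] [MeasurableSingletonClass ι] {P : Measure Ω} {lam : Measure E}
  {Y : Ω → E} {K : Ω → ι} {p g : ι → E → ℝ}

/-- Integrability of a function of a discrete variable `K` and of a variable `Y` that has the
(sub-probability) density `p j` on the event `K = j`. -/
theorem integrable_comp_iff_of_conditional_density (hY : Measurable Y) (hK : Measurable K)
    (hp : ∀ j, Measurable (p j)) (hp0 : ∀ j z, 0 ≤ p j z)
    (hlaw : ∀ j, (P.restrict (K ⁻¹' {j})).map Y = lam.withDensity fun z => ENNReal.ofReal (p j z))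
    (hg : ∀ j, Measurable (g j)) :
    Integrable (fun ω => g (K ω) (Y ω)) P ↔ ∀ j, Integrable (fun z => g j z * p j z) lam := by
  have hS : ∀ j, MeasurableSet (K ⁻¹' {j}) := fun j => hK (measurableSet_singleton j)
  have hU : (⋃ j, K ⁻¹' {j}) = Set.univ := by
    ext ω; simp
  rw [← integrableOn_univ, ← hU, integrableOn_finite_iUnion]
  refine forall_congr' fun j => ?_
  have h1 : IntegrableOn (fun ω => g (K ω) (Y ω)) (K ⁻¹' {j}) P ↔
      IntegrableOn (fun ω => g j (Y ω)) (K ⁻¹' {j}) P := by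
    refine integrableOn_congr_fun (fun ω hω => ?_) (hS j)
    have : K ω = j := hω
    simp only [this]
  have h2 : IntegrableOn (fun ω => g j (Y ω)) (K ⁻¹' {j}) P ↔
      Integrable (g j) ((P.restrict (K ⁻¹' {j})).map Y) :=
    (integrable_map_measure (hg j).aestronglyMeasurable hY.aemeasurable).symm
  rw [h1, h2, hlaw j, integrable_withDensity_iff (hp j).ennreal_ofReal
    (Filter.Eventually.of_forall fun _ => ENNReal.ofReal_lt_top)]
  simp only [ENNReal.toReal_ofReal (hp0 j _)]

theorem integral_comp_eq_of_conditional_density (hY : Measurable Y) (hK : Measurable K)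
    (hp : ∀ j, Measurable (p j)) (hp0 : ∀ j z, 0 ≤ p j z)
    (hlaw : ∀ j, (P.restrict (K ⁻¹' {j})).map Y = lam.withDensity fun z => ENNReal.ofReal (p j z))
    (hg : ∀ j, Measurable (g j)) (hint : Integrable (fun ω => g (K ω) (Y ω)) P) :
    ∫ ω, g (K ω) (Y ω) ∂P = ∑ j, ∫ z, g j z * p j z ∂lam := by
  have hS : ∀ j, MeasurableSet (K ⁻¹' {j}) := fun j => hK (measurableSet_singleton j)
  have hU : (⋃ j, K ⁻¹' {j}) = Set.univ := by
    ext ω; simp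
  have hd : Pairwise (Function.onFun Disjoint fun j => K ⁻¹' {j}) := fun i j hij =>
    Disjoint.preimage _ (Set.disjoint_singleton.2 hij)
  rw [← setIntegral_univ, ← hU, integral_iUnion_fintype hS hd fun j => hint.integrableOn]
  refine Finset.sum_congr rfl fun j _ => ?_
  have h1 : ∫ ω in K ⁻¹' {j}, g (K ω) (Y ω) ∂P = ∫ ω in K ⁻¹' {j}, g j (Y ω) ∂P := by
    refine setIntegral_congr_fun (hS j) fun ω hω => ?_
    have : K ω = j := hω
    simp only [this]
  rw [h1, ← integral_map hY.aemeasurable (hg j).aestronglyMeasurable, hlaw j,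
    integral_withDensity_eq_integral_toReal_smul (hp j).ennreal_ofReal
      (Filter.Eventually.of_forall fun _ => ENNReal.ofReal_lt_top)]
  refine integral_congr_ae (Filter.Eventually.of_forall fun z => ?_)
  simp only [ENNReal.toReal_ofReal (hp0 j z), smul_eq_mul, mul_comm]

/-- **Bayes' formula**: if `Y` has the density `p j` on the event `K = j`, then the conditional
expectation of `g (K, Y)` given `Y` is the average of the `g j` with weights proportional to
`p j`. -/
theorem condExp_comp_ae_eq_of_conditional_density [IsFiniteMeasure P] (hY : Measurable Y)
    (hK : Measurable K)
    (hp : ∀ j, Measurable (p j)) (hp0 : ∀ j z, 0 ≤ p j z) (hpos : ∀ z, 0 < ∑ j, p j z)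
    (hlaw : ∀ j, (P.restrict (K ⁻¹' {j})).map Y = lam.withDensity fun z => ENNReal.ofReal (p j z))
    (hg : ∀ j, Measurable (g j)) (hint : Integrable (fun ω => g (K ω) (Y ω)) P) :
    P[fun ω => g (K ω) (Y ω) | mE.comap Y] =ᵐ[P]
      fun ω => (∑ j, g j (Y ω) * p j (Y ω)) / ∑ j, p j (Y ω) := by
  set F : E → ℝ := fun z => (∑ j, g j z * p j z) / ∑ j, p j z with hF
  have hFm : Measurable F :=
    (Finset.measurable_sum _ fun j _ => (hg j).mul (hp j)).div
      (Finset.measurable_sum _ fun j _ => hp j)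
  have hgp := (integrable_comp_iff_of_conditional_density hY hK hp hp0 hlaw hg).1 hint
  have hFp : ∀ z, ∑ j, F z * p j z = ∑ j, g j z * p j z := fun z => by
    rw [← Finset.mul_sum, hF]
    exact div_mul_cancel₀ _ (hpos z).ne'
  -- Domination: `|F * p j| ≤ |F| * ∑ i, p i = |∑ i, g i * p i|`.
  have hFpi : ∀ j, Integrable (fun z => F z * p j z) lam := fun j => by
    refine (integrable_finsetSum Finset.univ fun i _ => hgp i).mono
      (hFm.mul (hp j)).aestronglyMeasurable (Filter.Eventually.of_forall fun z => ?_)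
    rw [← hFp z, ← Finset.mul_sum, norm_mul, norm_mul]
    refine mul_le_mul_of_nonneg_left ?_ (norm_nonneg _)
    rw [Real.norm_of_nonneg (hp0 j z), Real.norm_of_nonneg (hpos z).le]
    exact Finset.single_le_sum (f := fun i => p i z) (fun i _ => hp0 i z) (Finset.mem_univ j)
  have hFint : Integrable (fun ω => F (Y ω)) P :=
    (integrable_comp_iff_of_conditional_density (g := fun _ => F) hY hK hp hp0 hlaw
      fun _ => hFm).2 hFpi
  -- Integrals over events `Y ⁻¹' B` see `h` only through `∑ j, h j * p j`, and `g` and `F` share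
  -- this sum.
  have key : ∀ (h : ι → E → ℝ), (∀ j, Measurable (h j)) →
      Integrable (fun ω => h (K ω) (Y ω)) P → ∀ B : Set E, MeasurableSet B →
      ∫ ω in Y ⁻¹' B, h (K ω) (Y ω) ∂P = ∫ z in B, ∑ j, h j z * p j z ∂lam := by
    intro h hh hi B hB
    have hind : (fun ω => (Y ⁻¹' B).indicator (fun ω => h (K ω) (Y ω)) ω) =
        fun ω => (fun j => B.indicator (h j)) (K ω) (Y ω) := by
      ext ω; by_cases hω : Y ω ∈ B <;> simp [hω]
    rw [← integral_indicator (hY hB), hind,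
      integral_comp_eq_of_conditional_density (g := fun j => B.indicator (h j)) hY hK hp hp0 hlaw
        (fun j => (hh j).indicator hB) (by rw [← hind]; exact hi.indicator (hY hB)),
      integral_finsetSum _ fun j _ => ((integrable_comp_iff_of_conditional_density hY hK hp hp0
        hlaw hh).1 hi j).integrableOn]
    refine Finset.sum_congr rfl fun j _ => ?_
    rw [← integral_indicator hB]
    refine integral_congr_ae (Filter.Eventually.of_forall fun z => ?_)
    by_cases hz : z ∈ B <;> simp [hz]
  symm
  refine ae_eq_condExp_of_forall_setIntegral_eq hY.comap_le hint
    (fun s _ _ => hFint.integrableOn) ?_ ?_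
  · rintro s ⟨B, hB, rfl⟩ -
    rw [key g hg hint B hB, key (fun _ => F) (fun _ => hFm) hFint B hB]
    exact setIntegral_congr_fun hB fun z _ => hFp z
  · exact (hFm.comp (comap_measurable Y)).aestronglyMeasurable

end Bayes

/-! ### Measure preserving bijections and densities. -/

/-- A measurable bijection that agrees at every point with one of countably many
measure preserving ones is measure preserving. -/
theorem MeasurableEquiv.measurePreserving_of_piecewise {α ι : Type*} [MeasurableSpace α]
    [Countable ι] [MeasurableSpace ι] [MeasurableSingletonClass ι] {lam : Measure α}
    (e : α ≃ᵐ α) (d : ι → α ≃ᵐ α) (hd : ∀ i, MeasurePreserving (d i) lam lam)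
    (c : α → ι) (hc : Measurable c) (hed : ∀ x, e x = d (c x) x) :
    MeasurePreserving e lam lam := by
  refine ⟨e.measurable, ?_⟩
  ext B hB
  have hpre : MeasurableSet (e ⁻¹' B) := e.measurable hB
  have hcm : ∀ i, MeasurableSet (c ⁻¹' {i}) := fun i => hc (measurableSet_singleton i)
  have hdisj : Pairwise (Function.onFun Disjoint fun i => e ⁻¹' B ∩ c ⁻¹' {i}) := fun i j hij =>
    ((Set.disjoint_singleton.2 hij).preimage c).mono Set.inter_subset_right Set.inter_subset_right
  have h1 : e ⁻¹' B = ⋃ i, e ⁻¹' B ∩ c ⁻¹' {i} := by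
    ext x; simp
  have himg : ∀ i, e '' (e ⁻¹' B ∩ c ⁻¹' {i}) = d i '' (e ⁻¹' B ∩ c ⁻¹' {i}) := fun i =>
    Set.image_congr fun x hx => by rw [hed x, show c x = i from hx.2]
  have h2 : B = ⋃ i, e '' (e ⁻¹' B ∩ c ⁻¹' {i}) := by
    rw [← Set.image_iUnion, ← h1, Set.image_preimage_eq _ e.surjective]
  have hvol : ∀ i (S : Set α), MeasurableSet S → lam (d i '' S) = lam S := fun i S _ => by
    have := (hd i).measure_preimage_equiv (d i '' S)
    rwa [Set.preimage_image_eq _ (d i).injective, eq_comm] at this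
  rw [Measure.map_apply e.measurable hB]
  conv_rhs => rw [h2]
  conv_lhs => rw [h1]
  rw [measure_iUnion hdisj fun i => hpre.inter (hcm i),
    measure_iUnion (fun i j hij => (Set.disjoint_image_iff e.injective).2 (hdisj hij)) fun i =>
      e.measurableSet_image.2 (hpre.inter (hcm i))]
  refine tsum_congr fun i => ?_
  rw [himg, hvol i _ (hpre.inter (hcm i))]

theorem MeasureTheory.MeasurePreserving.map_withDensity_equiv {α : Type*} [MeasurableSpace α]
    {lam : Measure α} (e : α ≃ᵐ α) (he : MeasurePreserving e lam lam) (f : α → ENNReal) :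
    (lam.withDensity f).map e = lam.withDensity fun z => f (e.symm z) := by
  ext B hB
  rw [Measure.map_apply e.measurable hB, withDensity_apply _ (e.measurable hB),
    withDensity_apply _ hB,
    ← he.setLIntegral_comp_preimage_emb e.measurableEmbedding (fun z => f (e.symm z)) B]
  simp only [MeasurableEquiv.symm_apply_apply]

theorem measurable_toIcoMod {p : ℝ} (hp : 0 < p) (a : ℝ) : Measurable (toIcoMod hp a) := by
  have : toIcoMod hp a = fun b => a + Int.fract ((b - a) / p) * p := by
    ext b; exact toIcoMod_eq_add_fract_mul hp a b
  rw [this]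
  fun_prop

theorem measurable_toIcoDiv {p : ℝ} (hp : 0 < p) (a : ℝ) : Measurable (toIcoDiv hp a) := by
  have : toIcoDiv hp a = fun b => ⌊(b - a) / p⌋ := by
    ext b; exact toIcoDiv_eq_floor hp a b
  rw [this]
  fun_prop

/-! ### The encoding for a fixed key, as a bijection of the line. -/

noncomputable section

/-- The map that is a rotation by `c` of the window `[-θ, θ)`, and that is the identity or the
reflection (if `b`) outside `[-θ, θ]`. -/
def windowMap (θ : ℝ) (hθ : 0 < θ) (b : Prop) [Decidable b] (c x : ℝ) : ℝ :=
  if θ < |x| then if b then -x else x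
  else if x < θ then toIcoMod (mul_pos two_pos hθ) (-θ) (x + c) else x

variable {θ : ℝ} (hθ : 0 < θ) (b : Prop) [Decidable b]

theorem windowMap_of_lt_abs (c : ℝ) {x : ℝ} (hx : θ < |x|) :
    windowMap θ hθ b c x = if b then -x else x := by
  simp [windowMap, hx]

theorem windowMap_of_mem_Ico (c : ℝ) {x : ℝ} (hx : x ∈ Set.Ico (-θ) θ) :
    windowMap θ hθ b c x = toIcoMod (mul_pos two_pos hθ) (-θ) (x + c) := by
  have : ¬ θ < |x| := not_lt.2 (abs_le.2 ⟨hx.1, hx.2.le⟩)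
  simp [windowMap, this, hx.2]

theorem windowMap_right_end (c : ℝ) : windowMap θ hθ b c θ = θ := by
  simp [windowMap, abs_of_pos hθ]

theorem toIcoMod_window_mem (x : ℝ) :
    toIcoMod (mul_pos two_pos hθ) (-θ) x ∈ Set.Ico (-θ) θ := by
  have := toIcoMod_mem_Ico (mul_pos two_pos hθ) (-θ) x
  rwa [show -θ + 2 * θ = θ by ring] at this

theorem window_trichotomy {θ : ℝ} (x : ℝ) : θ < |x| ∨ x ∈ Set.Ico (-θ) θ ∨ x = θ := by
  rcases lt_or_ge θ |x| with h | h
  · exact Or.inl h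
  · obtain ⟨h1, h2⟩ := abs_le.1 h
    rcases h2.lt_or_eq with h2 | h2
    · exact Or.inr (Or.inl ⟨h1, h2⟩)
    · exact Or.inr (Or.inr h2)

/-- The exterior, the window and the point `θ` are each mapped to themselves; the reflection is an
involution, and opposite rotations cancel modulo `2 * θ`. -/
theorem windowMap_neg_windowMap (c x : ℝ) :
    windowMap θ hθ b (-c) (windowMap θ hθ b c x) = x := by
  rcases window_trichotomy (θ := θ) x with h | h | rfl
  · rw [windowMap_of_lt_abs hθ b c h]
    split_ifs with hb
    · rw [windowMap_of_lt_abs hθ b _ (by rwa [abs_neg]), if_pos hb, neg_neg]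
    · rw [windowMap_of_lt_abs hθ b _ h, if_neg hb]
  · rw [windowMap_of_mem_Ico hθ b c h,
      windowMap_of_mem_Ico hθ b _ (toIcoMod_window_mem hθ _), toIcoMod_eq_iff]
    refine ⟨by rwa [show -θ + 2 * θ = θ by ring],
      -toIcoDiv (mul_pos two_pos hθ) (-θ) (x + c), ?_⟩
    rw [← self_sub_toIcoDiv_zsmul]
    simp only [neg_smul]
    ring
  · rw [windowMap_right_end, windowMap_right_end]

theorem measurable_windowMap (c : ℝ) : Measurable (windowMap θ hθ b c) := by
  refine Measurable.ite (measurableSet_lt measurable_const measurable_id.abs) ?_ ?_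
  · split_ifs <;> fun_prop
  · exact Measurable.ite (measurableSet_lt measurable_id measurable_const)
      ((measurable_toIcoMod _ _).comp (measurable_id.add_const c)) measurable_id

/-- `windowMap` as a measurable bijection of the line. -/
def windowEquiv (c : ℝ) : ℝ ≃ᵐ ℝ where
  toFun := windowMap θ hθ b c
  invFun := windowMap θ hθ b (-c)
  left_inv x := windowMap_neg_windowMap hθ b c x
  right_inv x := by
    have := windowMap_neg_windowMap hθ b (-c) x
    rwa [neg_neg] at this
  measurable_toFun := measurable_windowMap hθ b c
  measurable_invFun := measurable_windowMap hθ b (-c)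

theorem measurePreserving_windowEquiv (c : ℝ) :
    MeasurePreserving (windowEquiv hθ b c) volume volume := by
  -- Pointwise the map is a reflection or a translation by `0` or by `c - n * (2 * θ)`. The integer
  -- label 0 is reserved for the identity, so `n ≥ 0` is stored as `n + 1` and `n < 0` as itself.
  refine (windowEquiv hθ b c).measurePreserving_of_piecewise (ι := Bool × ℤ)
    (fun i => if i.1 then MeasurableEquiv.neg ℝ else
      MeasurableEquiv.addRight (if i.2 = 0 then 0 else c - (i.2 - if 0 < i.2 then 1 else 0) * (2 * θ)))
    (fun i => ?_)
    (fun x => if θ < |x| then (decide b, 0) else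
      if x < θ then (false, toIcoDiv (mul_pos two_pos hθ) (-θ) (x + c) +
        if 0 ≤ toIcoDiv (mul_pos two_pos hθ) (-θ) (x + c) then 1 else 0) else (false, 0)) ?_ ?_
  · split_ifs
    · exact Measure.measurePreserving_neg volume
    all_goals exact measurePreserving_add_right volume _
  · have hm : Measurable fun x => toIcoDiv (mul_pos two_pos hθ) (-θ) (x + c) :=
      (measurable_toIcoDiv _ _).comp (measurable_id.add_const c)
    refine Measurable.ite (measurableSet_lt measurable_const measurable_id.abs) measurable_const
      (Measurable.ite (measurableSet_lt measurable_id measurable_const) ?_ measurable_const)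
    exact (Measurable.of_discrete (f := fun n : ℤ => (false, n + if 0 ≤ n then 1 else 0))).comp hm
  · intro x
    change windowMap θ hθ b c x = _
    rcases window_trichotomy (θ := θ) x with h | h | rfl
    · rw [windowMap_of_lt_abs hθ b c h]
      by_cases hb : b <;> simp [h, hb]
    · have h' : ¬ θ < |x| := not_lt.2 (abs_le.2 ⟨h.1, h.2.le⟩)
      rw [windowMap_of_mem_Ico hθ b c h, ← self_sub_toIcoDiv_zsmul]
      generalize toIcoDiv (mul_pos two_pos hθ) (-θ) (x + c) = n
      rw [if_neg h', if_pos h.2]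
      rcases le_or_gt 0 n with hn | hn
      · have h1 : n + 1 ≠ 0 := by omega
        have h2 : 0 < n + 1 := by omega
        simp [hn, h1, h2]
        ring
      · have h1 : ¬ 0 ≤ n := by omega
        have h2 : ¬ 0 < n := by omega
        simp [hn.ne, h1, h2]
        ring
    · simp [windowMap_right_end, abs_of_pos hθ]

end

/-! ### Numerical inequalities for the lattice moments. -/

theorem exp_window_ratio_bounds :
    4809220885798/10000000000000 ≤ Real.exp (-(1.21 ^ 2 / 2)) ∧ Real.exp (-(1.21 ^ 2 / 2)) ≤ 4809220885805/10000000000000 := by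
  have h := Real.exp_bound (x := -(1.21 ^ 2 / 2)) (by norm_num [abs_le]) (n := 16) (by norm_num)
  rw [abs_le] at h
  norm_num [Finset.sum_range_succ, Nat.factorial] at h ⊢
  constructor <;> linarith

/-- Beyond 0 and 1, these exponents are the sums `i ^ 2 + k ^ 2` with `-4 ≤ i, k ≤ 3`, which occur
in products of two weights. -/
theorem pow_bounds_of_window_ratio {q : ℝ} (h1 : 4809220885798/10000000000000 ≤ q) (h2 : q ≤ 4809220885805/10000000000000) :
    (2312860552839/10000000000000 ≤ q ^ 2 ∧ q ^ 2 ≤ 2312860552847/10000000000000) ∧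
    (534932393688/10000000000000 ≤ q ^ 4 ∧ q ^ 4 ≤ 534932393692/10000000000000) ∧
    (257260804021/10000000000000 ≤ q ^ 5 ∧ q ^ 5 ≤ 257260804024/10000000000000) ∧
    (28615266581/10000000000000 ≤ q ^ 8 ∧ q ^ 8 ≤ 28615266583/10000000000000) ∧
    (13761713769/10000000000000 ≤ q ^ 9 ∧ q ^ 9 ≤ 13761713770/10000000000000) ∧
    (6618312128/10000000000000 ≤ q ^ 10 ∧ q ^ 10 ≤ 6618312129/10000000000000) ∧
    (736158648/10000000000000 ≤ q ^ 13 ∧ q ^ 13 ≤ 736158649/10000000000000) ∧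
    (81883348/10000000000000 ≤ q ^ 16 ∧ q ^ 16 ≤ 81883349/10000000000000) ∧
    (39379510/10000000000000 ≤ q ^ 17 ∧ q ^ 17 ≤ 39379511/10000000000000) ∧
    (18938476/10000000000000 ≤ q ^ 18 ∧ q ^ 18 ≤ 18938477/10000000000000) ∧
    (4380205/10000000000000 ≤ q ^ 20 ∧ q ^ 20 ≤ 4380206/10000000000000) ∧
    (112685/10000000000000 ≤ q ^ 25 ∧ q ^ 25 ≤ 112686/10000000000000) ∧
    (670/10000000000000 ≤ q ^ 32 ∧ q ^ 32 ≤ 671/10000000000000) := by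
  have hl : ∀ n : ℕ, (4809220885798/10000000000000 : ℝ) ^ n ≤ q ^ n := fun n =>
    pow_le_pow_left₀ (by norm_num) h1 n
  have hu : ∀ n : ℕ, q ^ n ≤ (4809220885805/10000000000000 : ℝ) ^ n := fun n =>
    pow_le_pow_left₀ (le_trans (by norm_num) h1) h2 n
  refine ⟨⟨?_, ?_⟩, ⟨?_, ?_⟩, ⟨?_, ?_⟩, ⟨?_, ?_⟩, ⟨?_, ?_⟩, ⟨?_, ?_⟩, ⟨?_, ?_⟩, ⟨?_, ?_⟩, ⟨?_, ?_⟩, ⟨?_, ?_⟩, ⟨?_, ?_⟩, ⟨?_, ?_⟩, ⟨?_, ?_⟩⟩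
  all_goals first
    | exact le_trans (by norm_num) (hl _)
    | exact le_trans (hu _) (by norm_num)

/-- The total mass, the first and the second moment of the weights `q ^ (i ^ 2) * u ^ i`,
`-4 ≤ i ≤ 3`, multiplied by `u ^ 4`. -/
def latticeMoment (k : ℕ) (q u : ℝ) : ℝ :=
  (-4) ^ k * q ^ 16 + (-3) ^ k * (q ^ 9 * u) + (-2) ^ k * (q ^ 4 * u ^ 2) + (-1) ^ k * (q * u ^ 3) +
    0 ^ k * u ^ 4 + 1 ^ k * (q * u ^ 5) + 2 ^ k * (q ^ 4 * u ^ 6) + 3 ^ k * (q ^ 9 * u ^ 7)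

/-- Nonnegativity on `[23/100, 1]` from nonnegative Bernstein coefficients. -/
theorem window_polynomial_nonneg {u : ℝ} (hu0 : 23 / 100 ≤ u) (hu1 : u ≤ 1) :
    0 ≤ (-671/10000000000000) * u ^ 0 +
      (-7543/1250000000000) * u ^ 1 +
      (-408223/2000000000000) * u ^ 2 +
      (1148591/250000000000) * u ^ 3 +
      (-1329604701/10000000000000) * u ^ 4 +
      (17418288001/10000000000000) * u ^ 5 +
      (-107244657671/10000000000000) * u ^ 6 +
      (162812241657/5000000000000) * u ^ 7 +
      (-231844192903/5000000000000) * u ^ 8 +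
      (65123324903/2000000000000) * u ^ 9 +
      (-107466769107/10000000000000) * u ^ 10 +
      (3211128551/2000000000000) * u ^ 11 +
      (-616807463/2000000000000) * u ^ 12 +
      (-394212957/10000000000000) * u ^ 13 +
      (-1893469/1000000000000) * u ^ 14 := by
  have hx : 0 ≤ u - 23 / 100 := by linarith
  have hy : 0 ≤ 1 - u := by linarith
  have e : (-671/10000000000000) * u ^ 0 +
      (-7543/1250000000000) * u ^ 1 +
      (-408223/2000000000000) * u ^ 2 +
      (1148591/250000000000) * u ^ 3 +
      (-1329604701/10000000000000) * u ^ 4 +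
      (17418288001/10000000000000) * u ^ 5 +
      (-107244657671/10000000000000) * u ^ 6 +
      (162812241657/5000000000000) * u ^ 7 +
      (-231844192903/5000000000000) * u ^ 8 +
      (65123324903/2000000000000) * u ^ 9 +
      (-107466769107/10000000000000) * u ^ 10 +
      (3211128551/2000000000000) * u ^ 11 +
      (-616807463/2000000000000) * u ^ 12 +
      (-394212957/10000000000000) * u ^ 13 +
      (-1893469/1000000000000) * u ^ 14 =
      49822992472951005383149253472269/257555099046722087448523609000000000000 * ((u - 23 / 100) ^ 0 * (1 - u) ^ 14) +
      46838218242126708437421390980227/3679358557810315534978908700000000000 * ((u - 23 / 100) ^ 1 * (1 - u) ^ 13) +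
      5567203538283611021584917174431/18396792789051577674894543500000000 * ((u - 23 / 100) ^ 2 * (1 - u) ^ 12) +
      1485593647404796905614143435309/367935855781031553497890870000000 * ((u - 23 / 100) ^ 3 * (1 - u) ^ 11) +
      2865186005575099979754292873/83621785404779898522247925000 * ((u - 23 / 100) ^ 4 * (1 - u) ^ 10) +
      128935019311902263349536433/668974283238239188177983400 * ((u - 23 / 100) ^ 5 * (1 - u) ^ 9) +
      4872397860770802455958071/6689742832382391881779834 * ((u - 23 / 100) ^ 6 * (1 - u) ^ 8) +
      43410463699987602017852880/23414099913338371586229419 * ((u - 23 / 100) ^ 7 * (1 - u) ^ 7) +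
      10628702620388363722069000/3344871416191195940889917 * ((u - 23 / 100) ^ 8 * (1 - u) ^ 6) +
      12272111084248427635000000/3344871416191195940889917 * ((u - 23 / 100) ^ 9 * (1 - u) ^ 5) +
      9520232590196455970000000/3344871416191195940889917 * ((u - 23 / 100) ^ 10 * (1 - u) ^ 4) +
      53850580662792853000000000/36793585578103155349789087 * ((u - 23 / 100) ^ 11 * (1 - u) ^ 3) +
      17614126222411800000000000/36793585578103155349789087 * ((u - 23 / 100) ^ 12 * (1 - u) ^ 2) +
      3240692287400000000000000/36793585578103155349789087 * ((u - 23 / 100) ^ 13 * (1 - u) ^ 1) +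
      1532277848000000000000000/257555099046722087448523609 * ((u - 23 / 100) ^ 14 * (1 - u) ^ 0) := by
    ring
  rw [e]
  -- `positivity` cannot sign a difference, but it can use the hypotheses on the atoms `x` and `y`.
  generalize u - 23 / 100 = x at hx
  generalize 1 - u = y at hy
  positivity

/-- The difference of the sides is a polynomial in `u`. Since `M₂ M₀ - M₁²` is the sum of `(i - k) ^
2 * wᵢ * wₖ` over pairs `i < k`, a pair at distance `d` has coefficient `1.21 ^ 2 * d ^ 2 - 2 *
0.9998`, and a square `wᵢ ^ 2` has `-0.9998`. As `u ≥ 0`, each coefficient may be replaced by a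
rational lower bound. -/
theorem latticeMoment_variance_lower {q u : ℝ} (h1 : 4809220885798/10000000000000 ≤ q) (h2 : q ≤ 4809220885805/10000000000000)
    (hu0 : 23 / 100 ≤ u) (hu1 : u ≤ 1) :
    0.9998 * latticeMoment 0 q u ^ 2 ≤ 1.21 ^ 2 *
      (latticeMoment 2 q u * latticeMoment 0 q u - latticeMoment 1 q u ^ 2) := by
  obtain ⟨⟨l2, u2⟩, ⟨l4, u4⟩, ⟨l5, u5⟩, ⟨l8, u8⟩, ⟨l9, u9⟩, ⟨l10, u10⟩, ⟨l13, u13⟩, ⟨l16, u16⟩, ⟨l17, u17⟩, ⟨l18, u18⟩, ⟨l20, u20⟩, ⟨l25, u25⟩, ⟨l32, u32⟩⟩ := pow_bounds_of_window_ratio h1 h2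
  have hu : 0 ≤ u := le_trans (by norm_num) hu0
  have c0 : (-671/10000000000000) * u ^ 0 ≤ ((-4999/5000) * q ^ 32) * u ^ 0 :=
    mul_le_mul_of_nonneg_right (by linarith) (pow_nonneg hu 0)
  have c1 : (-7543/1250000000000) * u ^ 1 ≤ ((-1071/2000) * q ^ 25) * u ^ 1 :=
    mul_le_mul_of_nonneg_right (by linarith) (pow_nonneg hu 1)
  have c2 : (-408223/2000000000000) * u ^ 2 ≤ ((-4999/5000) * q ^ 18 + (4821/1250) * q ^ 20) * u ^ 2 :=
    mul_le_mul_of_nonneg_right (by linarith) (pow_nonneg hu 2)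
  have c3 : (1148591/250000000000) * u ^ 3 ≤ ((-1071/2000) * q ^ 13 + (111773/10000) * q ^ 17) * u ^ 3 :=
    mul_le_mul_of_nonneg_right (by linarith) (pow_nonneg hu 3)
  have c4 : (-1329604701/10000000000000) * u ^ 4 ≤ ((-4999/5000) * q ^ 8 + (4821/1250) * q ^ 10 + (10713/500) * q ^ 16) * u ^ 4 :=
    mul_le_mul_of_nonneg_right (by linarith) (pow_nonneg hu 4)
  have c5 : (17418288001/10000000000000) * u ^ 5 ≤ ((-1071/2000) * q ^ 5 + (111773/10000) * q ^ 9 + (346029/10000) * q ^ 17) * u ^ 5 :=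
    mul_le_mul_of_nonneg_right (by linarith) (pow_nonneg hu 5)
  have c6 : (-107244657671/10000000000000) * u ^ 6 ≤ ((-4999/5000) * q ^ 2 + (4821/1250) * q ^ 4 + (10713/500) * q ^ 10 + (12677/250) * q ^ 20) * u ^ 6 :=
    mul_le_mul_of_nonneg_right (by linarith) (pow_nonneg hu 6)
  have c7 : (162812241657/5000000000000) * u ^ 7 ≤ ((-1071/2000) * q ^ 1 + (111773/10000) * q ^ 5 + (346029/10000) * q ^ 13 + (697413/10000) * q ^ 25) * u ^ 7 :=
    mul_le_mul_of_nonneg_right (by linarith) (pow_nonneg hu 7)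
  have c8 : (-231844192903/5000000000000) * u ^ 8 ≤ ((-4999/5000) + (4821/1250) * q ^ 2 + (10713/500) * q ^ 8 + (12677/250) * q ^ 18) * u ^ 8 :=
    mul_le_mul_of_nonneg_right (by linarith) (pow_nonneg hu 8)
  have c9 : (65123324903/2000000000000) * u ^ 9 ≤ ((-1071/2000) * q ^ 1 + (111773/10000) * q ^ 5 + (346029/10000) * q ^ 13) * u ^ 9 :=
    mul_le_mul_of_nonneg_right (by linarith) (pow_nonneg hu 9)
  have c10 : (-107466769107/10000000000000) * u ^ 10 ≤ ((-4999/5000) * q ^ 2 + (4821/1250) * q ^ 4 + (10713/500) * q ^ 10) * u ^ 10 :=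
    mul_le_mul_of_nonneg_right (by linarith) (pow_nonneg hu 10)
  have c11 : (3211128551/2000000000000) * u ^ 11 ≤ ((-1071/2000) * q ^ 5 + (111773/10000) * q ^ 9) * u ^ 11 :=
    mul_le_mul_of_nonneg_right (by linarith) (pow_nonneg hu 11)
  have c12 : (-616807463/2000000000000) * u ^ 12 ≤ ((-4999/5000) * q ^ 8 + (4821/1250) * q ^ 10) * u ^ 12 :=
    mul_le_mul_of_nonneg_right (by linarith) (pow_nonneg hu 12)
  have c13 : (-394212957/10000000000000) * u ^ 13 ≤ ((-1071/2000) * q ^ 13) * u ^ 13 :=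
    mul_le_mul_of_nonneg_right (by linarith) (pow_nonneg hu 13)
  have c14 : (-1893469/1000000000000) * u ^ 14 ≤ ((-4999/5000) * q ^ 18) * u ^ 14 :=
    mul_le_mul_of_nonneg_right (by linarith) (pow_nonneg hu 14)
  have e : 1.21 ^ 2 * (latticeMoment 2 q u * latticeMoment 0 q u - latticeMoment 1 q u ^ 2) -
      0.9998 * latticeMoment 0 q u ^ 2 = ((-4999/5000) * q ^ 32) * u ^ 0 +
      ((-1071/2000) * q ^ 25) * u ^ 1 +
      ((-4999/5000) * q ^ 18 + (4821/1250) * q ^ 20) * u ^ 2 +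
      ((-1071/2000) * q ^ 13 + (111773/10000) * q ^ 17) * u ^ 3 +
      ((-4999/5000) * q ^ 8 + (4821/1250) * q ^ 10 + (10713/500) * q ^ 16) * u ^ 4 +
      ((-1071/2000) * q ^ 5 + (111773/10000) * q ^ 9 + (346029/10000) * q ^ 17) * u ^ 5 +
      ((-4999/5000) * q ^ 2 + (4821/1250) * q ^ 4 + (10713/500) * q ^ 10 + (12677/250) * q ^ 20) * u ^ 6 +
      ((-1071/2000) * q ^ 1 + (111773/10000) * q ^ 5 + (346029/10000) * q ^ 13 + (697413/10000) * q ^ 25) * u ^ 7 +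
      ((-4999/5000) + (4821/1250) * q ^ 2 + (10713/500) * q ^ 8 + (12677/250) * q ^ 18) * u ^ 8 +
      ((-1071/2000) * q ^ 1 + (111773/10000) * q ^ 5 + (346029/10000) * q ^ 13) * u ^ 9 +
      ((-4999/5000) * q ^ 2 + (4821/1250) * q ^ 4 + (10713/500) * q ^ 10) * u ^ 10 +
      ((-1071/2000) * q ^ 5 + (111773/10000) * q ^ 9) * u ^ 11 +
      ((-4999/5000) * q ^ 8 + (4821/1250) * q ^ 10) * u ^ 12 +
      ((-1071/2000) * q ^ 13) * u ^ 13 +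
      ((-4999/5000) * q ^ 18) * u ^ 14 := by
    simp only [latticeMoment]
    ring
  have hs := window_polynomial_nonneg hu0 hu1
  rw [← sub_nonneg, e]
  refine hs.trans ?_
  gcongr ?_ + ?_ + ?_ + ?_ + ?_ + ?_ + ?_ + ?_ + ?_ + ?_ + ?_ + ?_ + ?_ + ?_ + ?_

theorem latticeMoment_variance_upper {q : ℝ} (h1 : 4809220885798/10000000000000 ≤ q) (h2 : q ≤ 4809220885805/10000000000000) :
    1.21 ^ 2 * (latticeMoment 2 q 1 * latticeMoment 0 q 1 - latticeMoment 1 q 1 ^ 2) <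
      0.99985 * latticeMoment 0 q 1 ^ 2 := by
  obtain ⟨⟨l2, u2⟩, ⟨l4, u4⟩, ⟨l5, u5⟩, ⟨l8, u8⟩, ⟨l9, u9⟩, ⟨l10, u10⟩, ⟨l13, u13⟩, ⟨l16, u16⟩, ⟨l17, u17⟩, ⟨l18, u18⟩, ⟨l20, u20⟩, ⟨l25, u25⟩, ⟨l32, u32⟩⟩ := pow_bounds_of_window_ratio h1 h2
  simp only [latticeMoment]
  ring_nf
  linarith

/-! ### Decoding and the eight candidate samples. -/

theorem shiftMirror_eq_windowMap (x : ℝ) (j : Fin (2 ^ 3)) :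
    shiftMirror 3 theta3 theta3_pos x j =
      windowMap theta3 theta3_pos (¬ (j : ℕ) < 2 ^ (3 - 1)) ((j : ℕ) * (2 * theta3 / 2 ^ 3)) x := by
  unfold shiftMirror windowMap
  split_ifs <;> rfl

/-- The sample that the key `j` decodes from the code `z`. -/
noncomputable def windowDecode (j : Fin (2 ^ 3)) (z : ℝ) : ℝ :=
  windowMap theta3 theta3_pos (¬ (j : ℕ) < 2 ^ (3 - 1)) (-((j : ℕ) * (2 * theta3 / 2 ^ 3))) z

theorem windowDecode_shiftMirror (x : ℝ) (j : Fin (2 ^ 3)) :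
    windowDecode j (shiftMirror 3 theta3 theta3_pos x j) = x := by
  rw [shiftMirror_eq_windowMap]
  exact windowMap_neg_windowMap _ _ _ _

theorem measurable_windowDecode (j : Fin (2 ^ 3)) : Measurable (windowDecode j) :=
  measurable_windowMap theta3_pos _ _

theorem windowDecode_theta3 (j : Fin (2 ^ 3)) : windowDecode j theta3 = theta3 :=
  windowMap_right_end theta3_pos _ _

/-- The sum of the values of `f` at the eight points of `s + 1.21 ℤ` in the window. -/
def latticeSum (f : ℝ → ℝ) (s : ℝ) : ℝ :=
  f (s + (-4) * 1.21) + f (s + (-3) * 1.21) + f (s + (-2) * 1.21) + f (s + (-1) * 1.21) +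
    f (s + 0 * 1.21) + f (s + 1 * 1.21) + f (s + 2 * 1.21) + f (s + 3 * 1.21)

/-- The window has length `9.68 = 8 * 1.21`, so decoding subtracts the key from the lattice index
modulo 8, with representatives `-4, …, 3`. -/
theorem windowDecode_lattice {s : ℝ} (hs : s ∈ Set.Ico (0 : ℝ) 1.21) {m : ℤ} (hm : -4 ≤ m)
    (hm' : m ≤ 3) (j : Fin (2 ^ 3)) :
    windowDecode j (s + m * 1.21) = s + (((m - (j : ℕ) + 4) % 8 - 4 : ℤ) : ℝ) * 1.21 := by
  obtain ⟨hs0, hs1⟩ := hs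
  have h1 : (-4 : ℝ) ≤ m := by exact_mod_cast hm
  have h2 : (m : ℝ) ≤ 3 := by exact_mod_cast hm'
  rw [windowDecode, windowMap_of_mem_Ico, toIcoMod_eq_iff]
  · have h3 := Int.emod_nonneg (m - (j : ℕ) + 4) (by norm_num : (8 : ℤ) ≠ 0)
    have h4 := Int.emod_lt_of_pos (m - (j : ℕ) + 4) (by norm_num : (0 : ℤ) < 8)
    have h5 := Int.mul_ediv_add_emod (m - (j : ℕ) + 4) 8
    generalize (m - (j : ℕ) + 4) % 8 = r at *
    generalize (m - (j : ℕ) + 4) / 8 = n at *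
    have h3' : (0 : ℝ) ≤ r := by exact_mod_cast h3
    have h4' : (r : ℝ) ≤ 7 := by exact_mod_cast (by omega : r ≤ 7)
    have h5' : 8 * (n : ℝ) + r = m - (j : ℕ) + 4 := by exact_mod_cast h5
    refine ⟨⟨?_, ?_⟩, n, ?_⟩
    · push_cast [theta3]; linarith
    · push_cast [theta3]; linarith
    · simp only [theta3, zsmul_eq_mul]
      push_cast
      linear_combination (-1.21) * h5'
  · constructor <;> norm_num [theta3] <;> linarith

/-- As the key varies, the index runs once through all residues modulo 8, whatever `m` is. -/
theorem sum_windowDecode_lattice {s : ℝ} (hs : s ∈ Set.Ico (0 : ℝ) 1.21) {m : ℤ} (hm : -4 ≤ m)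
    (hm' : m ≤ 3) (f : ℝ → ℝ) :
    ∑ j, f (windowDecode j (s + m * 1.21)) = latticeSum f s := by
  simp only [windowDecode_lattice hs hm hm', latticeSum]
  rw [show (2 ^ 3 : ℕ) = 8 from rfl, Fin.sum_univ_eight]
  interval_cases m <;> norm_num <;> ring

theorem exists_lattice_coordinates {z : ℝ} (hz : z ∈ Set.Ico (-theta3) theta3) :
    ∃ s ∈ Set.Ico (0 : ℝ) 1.21, ∃ m : ℤ, -4 ≤ m ∧ m ≤ 3 ∧ z = s + m * 1.21 := by
  obtain ⟨h1, h2⟩ := hz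
  simp only [theta3] at h1 h2
  have h3 := Int.floor_le (z / 1.21)
  have h4 := Int.lt_floor_add_one (z / 1.21)
  rw [le_div_iff₀ (by norm_num)] at h3
  rw [div_lt_iff₀ (by norm_num)] at h4
  refine ⟨z - ⌊z / 1.21⌋ * 1.21, ⟨by linarith, by linarith⟩, ⌊z / 1.21⌋, ?_, ?_, by ring⟩
  · rw [Int.le_floor, le_div_iff₀ (by norm_num)]; norm_num; linarith
  · rw [← Int.lt_add_one_iff, Int.floor_lt, div_lt_iff₀ (by norm_num)]; norm_num; linarith

/-- Expand `(s + 1.21 * i) ^ 2 / 2`. The common factor `c` absorbs `exp (-s ^ 2 / 2)` and `u ^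
(-4)`, the latter making all exponents of `u` natural; being independent of `f`, it cancels in
quotients. -/
theorem latticeSum_gaussian (s : ℝ) :
    ∃ c > 0, ∀ f : ℝ → ℝ, latticeSum (fun x => f x * gaussianPDFReal 0 1 x) s =
      c * (f (s + (-4) * 1.21) * Real.exp (-(1.21 ^ 2 / 2)) ^ 16 +
        f (s + (-3) * 1.21) * (Real.exp (-(1.21 ^ 2 / 2)) ^ 9 * Real.exp (-(1.21 * s))) +
        f (s + (-2) * 1.21) * (Real.exp (-(1.21 ^ 2 / 2)) ^ 4 * Real.exp (-(1.21 * s)) ^ 2) +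
        f (s + (-1) * 1.21) * (Real.exp (-(1.21 ^ 2 / 2)) * Real.exp (-(1.21 * s)) ^ 3) +
        f (s + 0 * 1.21) * Real.exp (-(1.21 * s)) ^ 4 +
        f (s + 1 * 1.21) * (Real.exp (-(1.21 ^ 2 / 2)) * Real.exp (-(1.21 * s)) ^ 5) +
        f (s + 2 * 1.21) * (Real.exp (-(1.21 ^ 2 / 2)) ^ 4 * Real.exp (-(1.21 * s)) ^ 6) +
        f (s + 3 * 1.21) * (Real.exp (-(1.21 ^ 2 / 2)) ^ 9 * Real.exp (-(1.21 * s)) ^ 7)) := by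
  refine ⟨(Real.sqrt (2 * Real.pi))⁻¹ * Real.exp (-(s ^ 2 / 2) + 4 * 1.21 * s), by positivity, ?_⟩
  intro f
  have key : ∀ (x : ℝ) (a b : ℕ), (a : ℝ) = x ^ 2 → (b : ℝ) = x + 4 →
      gaussianPDFReal 0 1 (s + x * 1.21) =
        (Real.sqrt (2 * Real.pi))⁻¹ * Real.exp (-(s ^ 2 / 2) + 4 * 1.21 * s) *
          (Real.exp (-(1.21 ^ 2 / 2)) ^ a * Real.exp (-(1.21 * s)) ^ b) := by
    intro x a b ha hb
    rw [gaussianPDFReal, ← Real.exp_nat_mul, ← Real.exp_nat_mul, ← Real.exp_add, mul_assoc _ (Real.exp _),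
      ← Real.exp_add, ha, hb]
    simp only [NNReal.coe_one, mul_one, sub_zero]
    congr 2
    ring
  rw [latticeSum, key (-4) 16 0 (by norm_num) (by norm_num),
    key (-3) 9 1 (by norm_num) (by norm_num), key (-2) 4 2 (by norm_num) (by norm_num),
    key (-1) 1 3 (by norm_num) (by norm_num), key 0 0 4 (by norm_num) (by norm_num),
    key 1 1 5 (by norm_num) (by norm_num), key 2 4 6 (by norm_num) (by norm_num),
    key 3 9 7 (by norm_num) (by norm_num)]
  ring

/-! ### The posterior variance and its bounds. -/

/-- The variance of the standardized sample given its code `z`. -/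
noncomputable def posteriorVar (z : ℝ) : ℝ :=
  (∑ j, windowDecode j z ^ 2 * gaussianPDFReal 0 1 (windowDecode j z)) /
      (∑ j, gaussianPDFReal 0 1 (windowDecode j z)) -
    ((∑ j, windowDecode j z * gaussianPDFReal 0 1 (windowDecode j z)) /
      (∑ j, gaussianPDFReal 0 1 (windowDecode j z))) ^ 2

theorem latticeMoment_zero_pos {q u : ℝ} (hq : 0 < q) (hu : 0 < u) : 0 < latticeMoment 0 q u := by
  simp only [latticeMoment, pow_zero]
  positivity

/-- Variance ignores the translation by `s` and scales by `1.21 ^ 2`. -/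
theorem posteriorVar_lattice {s : ℝ} (hs : s ∈ Set.Ico (0 : ℝ) 1.21) {m : ℤ} (hm : -4 ≤ m)
    (hm' : m ≤ 3) {q u : ℝ} (hq : q = Real.exp (-(1.21 ^ 2 / 2)))
    (hu : u = Real.exp (-(1.21 * s))) :
    posteriorVar (s + m * 1.21) =
      1.21 ^ 2 * (latticeMoment 2 q u * latticeMoment 0 q u - latticeMoment 1 q u ^ 2) /
        latticeMoment 0 q u ^ 2 := by
  have hL : 0 < latticeMoment 0 q u :=
    latticeMoment_zero_pos (hq ▸ Real.exp_pos _) (hu ▸ Real.exp_pos _)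
  obtain ⟨c, hc, h⟩ := latticeSum_gaussian s
  rw [← hq, ← hu] at h
  have h0 := h fun _ => 1
  have h1 := h fun x => x
  have h2 := h fun x => x ^ 2
  rw [← sum_windowDecode_lattice hs hm hm'] at h0 h1 h2
  simp only [one_mul] at h0
  rw [posteriorVar, h0, h1, h2]
  have e0 : q ^ 16 + q ^ 9 * u + q ^ 4 * u ^ 2 + q * u ^ 3 + u ^ 4 + q * u ^ 5 + q ^ 4 * u ^ 6 +
      q ^ 9 * u ^ 7 = latticeMoment 0 q u := by
    simp only [latticeMoment]; ring
  have e1 : (s + (-4) * 1.21) * q ^ 16 + (s + (-3) * 1.21) * (q ^ 9 * u) +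
      (s + (-2) * 1.21) * (q ^ 4 * u ^ 2) + (s + (-1) * 1.21) * (q * u ^ 3) +
      (s + 0 * 1.21) * u ^ 4 + (s + 1 * 1.21) * (q * u ^ 5) + (s + 2 * 1.21) * (q ^ 4 * u ^ 6) +
      (s + 3 * 1.21) * (q ^ 9 * u ^ 7) =
      s * latticeMoment 0 q u + 1.21 * latticeMoment 1 q u := by
    simp only [latticeMoment]; ring
  have e2 : (s + (-4) * 1.21) ^ 2 * q ^ 16 + (s + (-3) * 1.21) ^ 2 * (q ^ 9 * u) +
      (s + (-2) * 1.21) ^ 2 * (q ^ 4 * u ^ 2) + (s + (-1) * 1.21) ^ 2 * (q * u ^ 3) +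
      (s + 0 * 1.21) ^ 2 * u ^ 4 + (s + 1 * 1.21) ^ 2 * (q * u ^ 5) +
      (s + 2 * 1.21) ^ 2 * (q ^ 4 * u ^ 6) + (s + 3 * 1.21) ^ 2 * (q ^ 9 * u ^ 7) =
      s ^ 2 * latticeMoment 0 q u + 2 * s * 1.21 * latticeMoment 1 q u +
        1.21 ^ 2 * latticeMoment 2 q u := by
    simp only [latticeMoment]; ring
  rw [e0, e1, e2]
  field_simp
  ring

theorem posteriorVar_of_lt_abs {z : ℝ} (hz : theta3 < |z|) : posteriorVar z = z ^ 2 := by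
  have h : ∀ j : Fin (2 ^ 3), windowDecode j z = if (j : ℕ) < 4 then z else -z := fun j => by
    rw [windowDecode, windowMap_of_lt_abs _ _ _ hz]
    by_cases hj : (j : ℕ) < 4 <;> simp [hj]
  have he : gaussianPDFReal 0 1 (-z) = gaussianPDFReal 0 1 z := by simp [gaussianPDFReal]
  have hp := gaussianPDFReal_pos 0 1 z one_ne_zero
  simp only [posteriorVar, h]
  rw [show (2 ^ 3 : ℕ) = 8 from rfl]
  simp only [Fin.sum_univ_eight]
  norm_num [he]
  field_simp

/-- The point `theta3` is excluded because every key decodes it to itself, so the variance there is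
zero. -/
theorem le_posteriorVar {z : ℝ} (hz : z ≠ theta3) : 0.9998 ≤ posteriorVar z := by
  rcases window_trichotomy (θ := theta3) z with h | h | h
  · rw [posteriorVar_of_lt_abs h, ← sq_abs]
    have h1 : 1 < |z| := lt_trans (by norm_num [theta3]) h
    nlinarith
  · obtain ⟨s, hs, m, hm, hm', rfl⟩ := exists_lattice_coordinates h
    obtain ⟨hq1, hq2⟩ := exp_window_ratio_bounds
    rw [posteriorVar_lattice hs hm hm' rfl rfl, le_div_iff₀ (pow_pos (latticeMoment_zero_pos
      (Real.exp_pos _) (Real.exp_pos _)) 2)]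
    refine latticeMoment_variance_lower hq1 hq2 ?_ ?_
    -- Since `s < 1.21`, `u ≥ q ^ 2 > 0.23`; this is the origin of the left end of the interval for
    -- `u`.
    · have h1 : Real.exp (-(1.21 ^ 2 / 2)) ^ 2 ≤ Real.exp (-(1.21 * s)) := by
        rw [← Real.exp_nat_mul]
        refine Real.exp_le_exp.2 ?_
        have := hs.2
        norm_num at this ⊢
        linarith
      nlinarith
    · rw [Real.exp_le_one_iff]
      have := hs.1
      linarith
  · exact absurd h hz

/-- The strict inequality at `s = 0` persists nearby. An interval is needed because a single code is
invisible to the essential infimum. -/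
theorem exists_posteriorVar_lt : ∃ ε > 0, ∀ z ∈ Set.Ioo 0 ε, posteriorVar z < 0.99985 := by
  obtain ⟨hq1, hq2⟩ := exp_window_ratio_bounds
  set q := Real.exp (-(1.21 ^ 2 / 2)) with hq
  have hc : Continuous fun s : ℝ => 1.21 ^ 2 * (latticeMoment 2 q (Real.exp (-(1.21 * s))) *
      latticeMoment 0 q (Real.exp (-(1.21 * s))) - latticeMoment 1 q (Real.exp (-(1.21 * s))) ^ 2) -
      0.99985 * latticeMoment 0 q (Real.exp (-(1.21 * s))) ^ 2 := by
    unfold latticeMoment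
    fun_prop
  have h0 := latticeMoment_variance_upper hq1 hq2
  have hev := hc.continuousAt.eventually_lt (x₀ := 0) (continuousAt_const (y := (0 : ℝ)))
    (by simpa using h0)
  obtain ⟨ε, hε, h⟩ := Metric.eventually_nhds_iff.1 hev
  refine ⟨min ε 1.21, by positivity, fun z hz => ?_⟩
  have hz2 := lt_min_iff.1 hz.2
  have hs : z ∈ Set.Ico (0 : ℝ) 1.21 := ⟨hz.1.le, hz2.2⟩
  have e := posteriorVar_lattice hs (m := 0) (by norm_num) (by norm_num) hq rfl
  rw [Int.cast_zero, zero_mul, add_zero] at e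
  rw [e, div_lt_iff₀ (pow_pos (latticeMoment_zero_pos (hq ▸ Real.exp_pos _) (Real.exp_pos _)) 2),
    ← sub_neg]
  exact h (by rw [Real.dist_eq, sub_zero, abs_of_pos hz.1]; exact hz2.1)

/-! ### Distributions and the eavesdropper's conditional variance. -/

section Eavesdropper

variable {Ω : Type*} {μ σ : ℝ} {X : Ω → ℝ} {K : Ω → Fin (2 ^ 3)}

/-- The encoded standardized sample. -/
noncomputable def maskedSample (μ σ : ℝ) (X : Ω → ℝ) (K : Ω → Fin (2 ^ 3)) (ω : Ω) : ℝ :=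
  shiftMirror 3 theta3 theta3_pos ((X ω - μ) / σ) (K ω)

theorem windowDecode_maskedSample (ω : Ω) :
    windowDecode (K ω) (maskedSample μ σ X K ω) = (X ω - μ) / σ :=
  windowDecode_shiftMirror _ _

/-- The first two coordinates are constants, so `y ↦ (μ, σ ^ 2, y)` is a measurable embedding and
they add no information. -/
theorem comap_transmit_eq (X : Ω → ℝ) (K : Ω → Fin (2 ^ 3)) :
    (inferInstance : MeasurableSpace (ℝ × ℝ × ℝ)).comap (fun ω => transmit μ σ (X ω) (K ω)) =
      (inferInstance : MeasurableSpace ℝ).comap (maskedSample μ σ X K) := by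
  have h : (fun ω => transmit μ σ (X ω) (K ω)) =
      (fun y : ℝ => (μ, σ ^ 2, y)) ∘ maskedSample μ σ X K := rfl
  have he : MeasurableEmbedding fun y : ℝ => (μ, σ ^ 2, y) :=
    (measurableEmbedding_prodMk_left μ).comp (measurableEmbedding_prodMk_left (σ ^ 2))
  rw [h, ← MeasurableSpace.comap_comp]
  congr 1
  exact he.comap_eq

variable [MeasurableSpace Ω] {P : Measure Ω}

theorem perfectDistortion_eq (hX : Measurable X)
    (hXlaw : P.map X = gaussianReal μ (σ ^ 2).toNNReal) : perfectDistortion P X = σ ^ 2 := by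
  rw [perfectDistortion, ← variance_id_map hX.aemeasurable, hXlaw, variance_id_gaussianReal,
    Real.coe_toNNReal _ (sq_nonneg σ)]

/-- The law of a masked sample on the event that the key takes a given value. -/
theorem map_restrict_masked_eq_withDensity {ι : Type*} [MeasurableSpace ι]
    [MeasurableSingletonClass ι] {lam : Measure ℝ} {V : Ω → ℝ} {K : Ω → ι} (hV : Measurable V)
    (hK : Measurable K) (hind : IndepFun V K P) {f : ℝ → ENNReal} (hf : Measurable f)
    (hlaw : P.map V = lam.withDensity f)
    (e : ι → ℝ ≃ᵐ ℝ) (he : ∀ j, MeasurePreserving (e j) lam lam) (j : ι) :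
    (P.restrict (K ⁻¹' {j})).map (fun ω => e (K ω) (V ω)) =
      lam.withDensity fun z => P (K ⁻¹' {j}) * f ((e j).symm z) := by
  have hS : MeasurableSet (K ⁻¹' {j}) := hK (measurableSet_singleton j)
  have h1 : (P.restrict (K ⁻¹' {j})).map (fun ω => e (K ω) (V ω)) =
      (P.restrict (K ⁻¹' {j})).map (e j ∘ V) := by
    refine Measure.map_congr ((ae_restrict_iff' hS).2 (Filter.Eventually.of_forall fun ω hω => ?_))
    have : K ω = j := hω
    simp only [this, Function.comp_apply]
  have h2 : (P.restrict (K ⁻¹' {j})).map V = P (K ⁻¹' {j}) • P.map V := by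
    ext B hB
    rw [Measure.map_apply hV hB, Measure.restrict_apply (hV hB), Measure.smul_apply,
      Measure.map_apply hV hB, hind.measure_inter_preimage_eq_mul B {j} hB
        (measurableSet_singleton j), smul_eq_mul, mul_comm]
  rw [h1, ← Measure.map_map (e j).measurable hV, h2, Measure.map_smul, hlaw,
    (he j).map_withDensity_equiv]
  exact (withDensity_smul (P (K ⁻¹' {j})) (hf.comp (e j).symm.measurable)).symm

theorem map_standardize_eq_gaussianReal {μ σ : ℝ} (hσ : 0 < σ) {X : Ω → ℝ} (hX : Measurable X)
    (hlaw : P.map X = gaussianReal μ (σ ^ 2).toNNReal) :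
    P.map (fun ω => (X ω - μ) / σ) = gaussianReal 0 1 := by
  have h : (fun ω => (X ω - μ) / σ) = (fun x => x / σ) ∘ (fun x => x - μ) ∘ X := rfl
  rw [h, ← Measure.map_map (by fun_prop) (by fun_prop), ← Measure.map_map (by fun_prop) hX, hlaw,
    gaussianReal_map_sub_const, gaussianReal_map_div_const]
  congr 1
  · simp
  · ext
    have : (σ ^ 2) ≠ 0 := by positivity
    simp [max_eq_left (sq_nonneg σ), this]

theorem measurable_maskedSample (hX : Measurable X) (hK : Measurable K) :
    Measurable (maskedSample μ σ X K) := by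
  have h : Measurable fun c : ℝ × Fin (2 ^ 3) => shiftMirror 3 theta3 theta3_pos c.1 c.2 :=
    measurable_from_prod_countable_left fun j => by
      simp only [shiftMirror_eq_windowMap]
      exact measurable_windowMap _ _ _
  exact h.comp (((hX.sub_const μ).div_const σ).prodMk hK)

/-- The factor `1 / 8` is the probability of the key; no Jacobian appears because the encoding
preserves Lebesgue measure. -/
theorem map_restrict_maskedSample (hσ : 0 < σ) (hX : Measurable X) (hK : Measurable K)
    (hXlaw : P.map X = gaussianReal μ (σ ^ 2).toNNReal)
    (hKlaw : P.map K = (PMF.uniformOfFintype (Fin (2 ^ 3))).toMeasure) (hind : IndepFun X K P)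
    (j : Fin (2 ^ 3)) :
    (P.restrict (K ⁻¹' {j})).map (maskedSample μ σ X K) = volume.withDensity fun z =>
      ENNReal.ofReal (1 / 8 * gaussianPDFReal 0 1 (windowDecode j z)) := by
  have hV : Measurable fun ω => (X ω - μ) / σ := (hX.sub_const μ).div_const σ
  have hindV : IndepFun (fun ω => (X ω - μ) / σ) K P :=
    hind.comp (φ := fun x => (x - μ) / σ) (by fun_prop) measurable_id
  have hlaw := map_standardize_eq_gaussianReal hσ hX hXlaw
  rw [gaussianReal_of_var_ne_zero _ one_ne_zero] at hlaw
  have h := map_restrict_masked_eq_withDensity hV hK hindV (measurable_gaussianPDF 0 1) hlaw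
    (fun j : Fin (2 ^ 3) => windowEquiv theta3_pos (¬ (j : ℕ) < 2 ^ (3 - 1))
      ((j : ℕ) * (2 * theta3 / 2 ^ 3))) (fun j => measurePreserving_windowEquiv _ _ _) j
  have hY : maskedSample μ σ X K = fun ω => windowEquiv theta3_pos (¬ (K ω : ℕ) < 2 ^ (3 - 1))
      ((K ω : ℕ) * (2 * theta3 / 2 ^ 3)) ((X ω - μ) / σ) := by
    ext ω
    exact shiftMirror_eq_windowMap _ _
  have hPK : P (K ⁻¹' {j}) = ENNReal.ofReal (1 / 8) := by
    rw [← Measure.map_apply hK (measurableSet_singleton j), hKlaw,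
      PMF.toMeasure_apply_singleton _ _ (measurableSet_singleton j), PMF.uniformOfFintype_apply,
      one_div, ENNReal.ofReal_inv_of_pos (by norm_num)]
    norm_num
  rw [hY, h, hPK]
  congr 1
  ext z
  rw [ENNReal.ofReal_mul (by norm_num)]
  rfl

/-- By decoding, `X` and `X ^ 2` are functions of the key and the code, so Bayes' formula gives both
terms of `E[X² | Z] - E[X | Z]²`; the shift `μ` then drops out. -/
theorem condVar_transmit_ae_eq [IsProbabilityMeasure P] (hσ : 0 < σ)
    (hX : Measurable X) (hK : Measurable K)
    (hXlaw : P.map X = gaussianReal μ (σ ^ 2).toNNReal)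
    (hKlaw : P.map K = (PMF.uniformOfFintype (Fin (2 ^ 3))).toMeasure) (hind : IndepFun X K P) :
    Var[X; P | (inferInstance : MeasurableSpace (ℝ × ℝ × ℝ)).comap
      (fun ω => transmit μ σ (X ω) (K ω))] =ᵐ[P]
      fun ω => σ ^ 2 * posteriorVar (maskedSample μ σ X K ω) := by
  have hY := measurable_maskedSample (μ := μ) (σ := σ) hX hK
  have hXL : MemLp X 2 P := by
    have : MemLp id 2 (P.map X) := by
      rw [hXlaw]; exact memLp_id_gaussianReal 2
    exact (memLp_map_measure_iff this.1 hX.aemeasurable).1 this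
  have hp : ∀ j, Measurable fun z => 1 / 8 * gaussianPDFReal 0 1 (windowDecode j z) := fun j =>
    ((measurable_gaussianPDFReal 0 1).comp (measurable_windowDecode j)).const_mul _
  have hp0 : ∀ (j : Fin (2 ^ 3)) z, 0 < 1 / 8 * gaussianPDFReal 0 1 (windowDecode j z) :=
    fun j z => mul_pos (by norm_num) (gaussianPDFReal_pos _ _ _ one_ne_zero)
  have hpos : ∀ z, 0 < ∑ j, 1 / 8 * gaussianPDFReal 0 1 (windowDecode j z) := fun z =>
    Finset.sum_pos (fun j _ => hp0 j z) Finset.univ_nonempty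
  have hbayes := fun {g : Fin (2 ^ 3) → ℝ → ℝ} => condExp_comp_ae_eq_of_conditional_density
    (g := g) hY hK hp (fun j z => (hp0 j z).le) hpos
    (map_restrict_maskedSample hσ hX hK hXlaw hKlaw hind)
  have hg : ∀ j, Measurable fun z => σ * windowDecode j z + μ := fun j =>
    ((measurable_windowDecode j).const_mul σ).add_const μ
  have hXg : X = fun ω => σ * windowDecode (K ω) (maskedSample μ σ X K ω) + μ := by
    ext ω
    rw [windowDecode_maskedSample]
    field_simp
    ring
  have hXg2 : X ^ 2 = fun ω => (σ * windowDecode (K ω) (maskedSample μ σ X K ω) + μ) ^ 2 := by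
    conv_lhs => rw [hXg]
    rfl
  have h1 := hbayes (g := fun j z => σ * windowDecode j z + μ) hg
    (by rw [← hXg]; exact hXL.integrable one_le_two)
  have h2 := hbayes (g := fun j z => (σ * windowDecode j z + μ) ^ 2) (fun j => (hg j).pow_const 2)
    (by rw [← hXg2]; exact hXL.integrable_sq)
  rw [← hXg] at h1
  rw [← hXg2] at h2
  rw [comap_transmit_eq]
  filter_upwards [condVar_ae_eq_condExp_sq_sub_sq_condExp hY.comap_le hXL, h1, h2] with ω h h1 h2
  rw [h, Pi.sub_apply, Pi.pow_apply, h1, h2, posteriorVar]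
  generalize maskedSample μ σ X K ω = z
  have hW : 0 < ∑ j, gaussianPDFReal 0 1 (windowDecode j z) :=
    Finset.sum_pos (fun j _ => gaussianPDFReal_pos _ _ _ one_ne_zero) Finset.univ_nonempty
  have e0 : ∑ j, 1 / 8 * gaussianPDFReal 0 1 (windowDecode j z) =
      1 / 8 * ∑ j, gaussianPDFReal 0 1 (windowDecode j z) := by rw [Finset.mul_sum]
  have e1 : ∑ j, (σ * windowDecode j z + μ) * (1 / 8 * gaussianPDFReal 0 1 (windowDecode j z)) =
      1 / 8 * (σ * (∑ j, windowDecode j z * gaussianPDFReal 0 1 (windowDecode j z)) +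
        μ * ∑ j, gaussianPDFReal 0 1 (windowDecode j z)) := by
    simp only [Finset.mul_sum, ← Finset.sum_add_distrib]
    exact Finset.sum_congr rfl fun j _ => by ring
  have e2 : ∑ j, (σ * windowDecode j z + μ) ^ 2 *
        (1 / 8 * gaussianPDFReal 0 1 (windowDecode j z)) =
      1 / 8 * (σ ^ 2 * (∑ j, windowDecode j z ^ 2 * gaussianPDFReal 0 1 (windowDecode j z)) +
        2 * σ * μ * (∑ j, windowDecode j z * gaussianPDFReal 0 1 (windowDecode j z)) +
        μ ^ 2 * ∑ j, gaussianPDFReal 0 1 (windowDecode j z)) := by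
    simp only [Finset.mul_sum, ← Finset.sum_add_distrib]
    exact Finset.sum_congr rfl fun j _ => by ring
  rw [e0, e1, e2]
  field_simp
  ring

theorem ae_maskedSample_ne (hσ : 0 < σ) (hX : Measurable X)
    (hXlaw : P.map X = gaussianReal μ (σ ^ 2).toNNReal) :
    ∀ᵐ ω ∂P, maskedSample μ σ X K ω ≠ theta3 := by
  have hV : Measurable fun ω => (X ω - μ) / σ := (hX.sub_const μ).div_const σ
  have hlaw := map_standardize_eq_gaussianReal hσ hX hXlaw
  have h0 : P ((fun ω => (X ω - μ) / σ) ⁻¹' {theta3}) = 0 := by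
    rw [← Measure.map_apply hV (measurableSet_singleton _), hlaw]
    exact gaussianReal_absolutelyContinuous 0 one_ne_zero Real.volume_singleton
  refine measure_mono_null (fun ω hω => ?_) h0
  have h : maskedSample μ σ X K ω = theta3 := not_not.1 hω
  have := windowDecode_maskedSample (μ := μ) (σ := σ) (X := X) (K := K) ω
  rw [h, windowDecode_theta3] at this
  exact this.symm

theorem frequently_maskedSample_mem (hσ : 0 < σ) (hX : Measurable X) (hK : Measurable K)
    (hXlaw : P.map X = gaussianReal μ (σ ^ 2).toNNReal)
    (hKlaw : P.map K = (PMF.uniformOfFintype (Fin (2 ^ 3))).toMeasure) (hind : IndepFun X K P)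
    {B : Set ℝ} (hB : MeasurableSet B) (hB0 : volume B ≠ 0) :
    ∃ᶠ ω in ae P, maskedSample μ σ X K ω ∈ B := by
  intro h
  refine hB0 ?_
  have hY := measurable_maskedSample (μ := μ) (σ := σ) hX hK
  -- One key suffices: on the event `K = 0` the code already has an everywhere positive density.
  have h1 : (P.restrict (K ⁻¹' {0})).map (maskedSample μ σ X K) B = 0 := by
    rw [Measure.map_apply hY hB]
    refine le_antisymm ((Measure.restrict_le_self _).trans (le_of_eq ?_)) zero_le
    exact measure_mono_null (fun ω hω => not_not.2 hω) h
  rw [map_restrict_maskedSample hσ hX hK hXlaw hKlaw hind] at h1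
  refine withDensity_absolutelyContinuous' ?_ (Filter.Eventually.of_forall fun z => ?_) h1
  · exact (((measurable_gaussianPDFReal 0 1).comp
      (measurable_windowDecode 0)).const_mul _).ennreal_ofReal.aemeasurable
  · exact (ENNReal.ofReal_pos.2
      (mul_pos (by norm_num) (gaussianPDFReal_pos _ _ _ one_ne_zero))).ne'

theorem worstCaseDistortion_transmit_bounds [IsProbabilityMeasure P] (hσ : 0 < σ)
    (hX : Measurable X) (hK : Measurable K)
    (hXlaw : P.map X = gaussianReal μ (σ ^ 2).toNNReal)
    (hKlaw : P.map K = (PMF.uniformOfFintype (Fin (2 ^ 3))).toMeasure) (hind : IndepFun X K P) :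
    0.9998 * σ ^ 2 ≤ worstCaseDistortion P X (fun ω => transmit μ σ (X ω) (K ω)) ∧
      worstCaseDistortion P X (fun ω => transmit μ σ (X ω) (K ω)) ≤ 0.99985 * σ ^ 2 := by
  have hcv := condVar_transmit_ae_eq hσ hX hK hXlaw hKlaw hind
  have hσ2 : 0 < σ ^ 2 := by positivity
  have hlow : ∀ᵐ ω ∂P, 0.9998 * σ ^ 2 ≤ σ ^ 2 * posteriorVar (maskedSample μ σ X K ω) := by
    filter_upwards [ae_maskedSample_ne (K := K) hσ hX hXlaw] with ω hω
    rw [mul_comm]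
    exact mul_le_mul_of_nonneg_left (le_posteriorVar hω) hσ2.le
  have hfreq : ∃ᶠ ω in ae P, σ ^ 2 * posteriorVar (maskedSample μ σ X K ω) ≤ 0.99985 * σ ^ 2 := by
    obtain ⟨ε, hε, h⟩ := exists_posteriorVar_lt
    refine (frequently_maskedSample_mem hσ hX hK hXlaw hKlaw hind (B := Set.Ioo 0 ε)
      measurableSet_Ioo (by simpa using hε)).mono fun ω hω => ?_
    rw [mul_comm (0.99985 : ℝ)]
    exact mul_le_mul_of_nonneg_left (h _ hω).le hσ2.le
  rw [worstCaseDistortion, essInf_congr_ae hcv]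
  -- `essInf` is a `liminf` in `ℝ`, so each bound needs a boundedness side condition, which the
  -- opposite bound supplies.
  exact ⟨le_essInf_of_ae_le _ hlow (Filter.IsCoboundedUnder.of_frequently_le hfreq),
    Filter.liminf_le_of_frequently_le hfreq ⟨_, Filter.eventually_map.2 hlow⟩⟩

end Eavesdropper

/-! ### The theorem. -/

theorem mainTheorem4 :
    ∃ Γ : ℝ × ℝ × ℝ → Fin (2 ^ 3) → ℝ, (∀ j, Measurable fun c => Γ c j) ∧
      ∀ (μ σ : ℝ), 0 < σ →
        (∀ (x : ℝ) (j : Fin (2 ^ 3)), Γ (transmit μ σ x j) j = x) ∧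
        ∀ {Ω : Type*} [MeasurableSpace Ω] (P : Measure Ω) [IsProbabilityMeasure P]
          (X : Ω → ℝ) (K : Ω → Fin (2 ^ 3)), Measurable X → Measurable K →
          P.map X = gaussianReal μ (σ ^ 2).toNNReal →
          P.map K = (PMF.uniformOfFintype (Fin (2 ^ 3))).toMeasure →
          IndepFun X K P →
            perfectDistortion P X = σ ^ 2 ∧
            0.9998 * σ ^ 2 ≤ worstCaseDistortion P X (fun ω => transmit μ σ (X ω) (K ω)) ∧
            worstCaseDistortion P X (fun ω => transmit μ σ (X ω) (K ω)) ≤ 0.99985 * σ ^ 2 := by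
  -- The decoder reads `μ` and `σ` off the transmission itself; the square root returns `σ` because
  -- `σ > 0`.
  refine ⟨fun c j => Real.sqrt c.2.1 * windowDecode j c.2.2 + c.1, fun j => ?_, fun μ σ hσ =>
    ⟨fun x j => ?_, ?_⟩⟩
  · have := measurable_windowDecode j
    fun_prop
  · simp only [transmit, windowDecode_shiftMirror, Real.sqrt_sq hσ.le]
    field_simp
    ring
  · intro Ω _ P _ X K hX hK hXlaw hKlaw hind
    exact ⟨perfectDistortion_eq hX hXlaw,
      worstCaseDistortion_transmit_bounds hσ hX hK hXlaw hKlaw hind⟩
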